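/- Let $f\in\mathbb{Q}^2$, let $k\ge 0$ and $r^1,\dots,r^k\in\mathbb{Q}^2$, and put $R=\{r^1,\dots,r^k\}$. For a matrix $B\in\mathbb{R}^{3\times 2}$ with rows $b^1,b^2,b^3$ let $$M(B)=\{x\in\mathbb{R}^2 : b^i\cdot(x-f)\le 1 \text{ for } i=1,2,3\},\qquad \psi_B(r)=\max_{i} b^i\cdot r,\qquad \gamma(B)=(\psi_B(r^1),\dots,\psi_B(r^k))\in\mathbb{R}^k,$$ let $\mathrm{vert}(B)$ be the set of vertices of $M(B)$, and let $$P(B,R)=\Bigl\{f+\tfrac{1}{\psi_B(r)}\,r : r\in R,\ \psi_B(r)>0\Bigr\}$$ be the set of ray intersections. A set in $\mathbb{R}^2$ is lattice-free if its interior contains no point of $\mathbb{Z}^2$; a lattice-free convex set is maximal if it is not properly contained in another lattice-free convex set. A Type 3 triangle is a maximal lattice-free triangle with exactly three integral points on its boundary, one in the relative interior of each edge. Let $$\Delta=\{\gamma(B) : B\in\mathbb{R}^{3\times2},\ M(B)\text{ lattice-free}\},\qquad \Delta_3=\{\gamma(B) : B\in\mathbb{R}^{3\times2},\ M(B)\text{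 a Type 3 triangle}\}.$$ A point $x\in\mathbb{R}^k$ is called a strict convex combination of $y^1$ and $y^2$ if $y^1\ne y^2$ and $x=\frac12(y^1+y^2)$. Proposition (Counting Type 3 triangles). There exists a finite subset $\Xi_3\subseteq\Delta_3$ such that every $\gamma\in\Delta_3\setminus\Xi_3$ is a strict convex combination of some $\gamma^1,\gamma^2\in\Delta$. Moreover, the cardinality of $\Xi_3$ is bounded by a polynomial (one polynomial for all $k$, $f$, $r^1,\dots,r^k$) in the total binary encoding size of $f,r^1,\dots,r^k$. Specifically, $\Xi_3$ can be chosen as the set of all $\gamma(B)$ such that $M(B)$ is a Type 3 triangle and one of the following holds: Case a. $P(B,R)\subseteq\mathbb{Z}^2$. Case b. $M(B)$ has three corner rays, that is, $\mathrm{vert}(B)\subseteq P(B,R)$. Here the binary encoding size of a rational number $p/q$ in lowest terms with $q\ge1$ is $1+\lceil\log_2(|p|+1)\rceil+\lceil\log_2(q+1)\rceil$, and the size of the data is the sum of the sizes of all coordinates of $f,r^1,\dots,r^k$. -/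

import Mathlib

open Set
open scoped Matrix

noncomputable section

namespace TriangleClosure

/-- The integer lattice `ℤ²` inside `ℝ²`. -/
def lattice : Set (Fin 2 → ℝ) := {x | ∀ i, ∃ z : ℤ, x i = z}

/-- A set is lattice-free if its interior contains no integer point. -/
def LatticeFree (S : Set (Fin 2 → ℝ)) : Prop := interior S ∩ lattice = ∅

/-- A maximal lattice-free convex set: maximal for inclusion among the lattice-free convex sets. -/
def IsMaximalLatticeFree (S : Set (Fin 2 → ℝ)) : Prop :=
  Maximal (fun K : Set (Fin 2 → ℝ) => Convex ℝ K ∧ LatticeFree K) S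

/-- A Type 3 triangle: a maximal lattice-free triangle with exactly three integer points on its
boundary, one in the relative interior of each edge. -/
def IsType3Triangle (S : Set (Fin 2 → ℝ)) : Prop :=
  IsMaximalLatticeFree S ∧
    ∃ v : Fin 3 → Fin 2 → ℝ, AffineIndependent ℝ v ∧ S = convexHull ℝ (range v) ∧
      (frontier S ∩ lattice).ncard = 3 ∧
      ∀ i j, i ≠ j → ∃! y, y ∈ openSegment ℝ (v i) (v j) ∩ lattice

/-- `M(B) = {x | B (x - f) ≤ e}`, with `e` the all-ones vector. -/
def M (f : Fin 2 → ℝ) (B : Matrix (Fin 3) (Fin 2) ℝ) : Set (Fin 2 → ℝ) :=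
  {x | ∀ i, B i ⬝ᵥ (x - f) ≤ 1}

/-- `ψ_B(r) = max_i b^i · r`, where the `b^i` are the rows of `B`. -/
def psi (B : Matrix (Fin 3) (Fin 2) ℝ) (r : Fin 2 → ℝ) : ℝ :=
  Finset.univ.sup' Finset.univ_nonempty (fun i => B i ⬝ᵥ r)

/-- The coefficient vector `γ(B) = (ψ_B(r^j))_j`. -/
def gam {k : ℕ} (r : Fin k → Fin 2 → ℝ) (B : Matrix (Fin 3) (Fin 2) ℝ) : Fin k → ℝ :=
  fun j => psi B (r j)

/-- The set of vertices of `M(B)`. -/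
def verts (f : Fin 2 → ℝ) (B : Matrix (Fin 3) (Fin 2) ℝ) : Set (Fin 2 → ℝ) :=
  (M f B).extremePoints ℝ

/-- The ray intersections `P(B, R)`: all points `f + r / ψ_B(r)` with `r ∈ R` and `ψ_B(r) > 0`. -/
def rayIntersections (f : Fin 2 → ℝ) (B : Matrix (Fin 3) (Fin 2) ℝ) (R : Set (Fin 2 → ℝ)) :
    Set (Fin 2 → ℝ) :=
  {p | ∃ r ∈ R, 0 < psi B r ∧ p = f + (1 / psi B r) • r}

/-- `Δ`: all `γ(B)` with `M(B)` lattice-free (not necessarily maximal). -/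
def Delta {k : ℕ} (f : Fin 2 → ℝ) (r : Fin k → Fin 2 → ℝ) : Set (Fin k → ℝ) :=
  {γ | ∃ B : Matrix (Fin 3) (Fin 2) ℝ, LatticeFree (M f B) ∧ γ = gam r B}

/-- `Δ₃`: all `γ(B)` with `M(B)` a Type 3 triangle. -/
def Delta3 {k : ℕ} (f : Fin 2 → ℝ) (r : Fin k → Fin 2 → ℝ) : Set (Fin k → ℝ) :=
  {γ | ∃ B : Matrix (Fin 3) (Fin 2) ℝ, IsType3Triangle (M f B) ∧ γ = gam r B}

/-- `Ξ₃`: all `γ(B)` with `M(B)` a Type 3 triangle such that all ray intersections are integral,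
or every vertex of `M(B)` is a ray intersection (three corner rays). -/
def Xi3 {k : ℕ} (f : Fin 2 → ℝ) (r : Fin k → Fin 2 → ℝ) : Set (Fin k → ℝ) :=
  {γ | ∃ B : Matrix (Fin 3) (Fin 2) ℝ, IsType3Triangle (M f B) ∧
    (rayIntersections f B (range r) ⊆ lattice ∨
      verts f B ⊆ rayIntersections f B (range r)) ∧
    γ = gam r B}

/-- `x` is a strict convex combination of `y₁` and `y₂`: it is the midpoint of these two distinct
points. -/
def IsStrictConvexCombination {k : ℕ} (x y₁ y₂ : Fin k → ℝ) : Prop :=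
  y₁ ≠ y₂ ∧ x = (1 / 2 : ℝ) • (y₁ + y₂)

/-- Binary encoding size of a rational number `p / q` in lowest terms:
`1 + ⌈log₂ (|p| + 1)⌉ + ⌈log₂ (q + 1)⌉`. -/
def ratSize (q : ℚ) : ℕ := 1 + Nat.size q.num.natAbs + Nat.size q.den

/-- Binary encoding size of a rational vector in the plane. -/
def vecSize (v : Fin 2 → ℚ) : ℕ := ∑ i, ratSize (v i)

/-- Total binary encoding size of the data `f, r¹, …, rᵏ`. -/
def dataSize {k : ℕ} (f : Fin 2 → ℚ) (r : Fin k → Fin 2 → ℚ) : ℕ :=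
  vecSize f + ∑ j, vecSize (r j)

/-- A rational vector regarded as a real vector. -/
def toReal (v : Fin 2 → ℚ) : Fin 2 → ℝ := fun i => (v i : ℝ)

end TriangleClosure

end

namespace TriangleClosure

/-! ### Barycentric coordinates -/

/-! A Type 3 triangle is rigid only through its three boundary lattice points `y i`. Each edge can
be tilted about its own `y i`: adding to row `i` a functional that vanishes on `y i - f` keeps `y i`
on the line of edge `i`, and for small tilts no other lattice point enters the interior, since only
finitely many are near (`Inscribed.eventually_latticeFree`). The three tilt speeds have free scales.
If some vertex `b m` is not a ray intersection, the scales can be matched at the two other vertices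
(`Inscribed.exists_tilt`), so that every `psi` value is affine in the tilt parameter. Opposite tilts
then have midpoint `γ`, and they differ as soon as some ray intersection is not a lattice point
(`Inscribed.exists_strictConvexCombination`). It remains to count. Triangles whose ray intersections
are all integral give at most one vector (`subsingleton_integral`). With three corner rays, `y i` is
the unique lattice point minimizing a linear functional over the cone spanned at `f` by two rays.
Two such minimizers whose cone coordinates have the same binary logarithms coincide, because
otherwise reflecting one in the other gives a cheaper lattice point of the cone
(`CornerData.eq_of_log_eq`). Three ray indices and six logarithms thus determine the triangle, and
each logarithm is linearly bounded in the encoding size (`CornerData.log_mem`). -/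

theorem coord_add {ι : Type*} (b : AffineBasis ι ℝ (Fin 2 → ℝ)) (i : ι) (x w : Fin 2 → ℝ) :
    b.coord i (x + w) = b.coord i x + (b.coord i).linear w := by
  have h := (b.coord i).map_vadd x w
  simp only [vadd_eq_add] at h
  rw [add_comm x, h, add_comm]

theorem linear_sub {ι : Type*} (b : AffineBasis ι ℝ (Fin 2 → ℝ)) (i : ι) (x w : Fin 2 → ℝ) :
    (b.coord i).linear (x - w) = b.coord i x - b.coord i w := by
  have h := coord_add b i w (x - w)
  rw [add_sub_cancel] at h
  linarith

/-- The barycentric coordinates sum to one, so their linear parts sum to zero: nonnegative ones all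
vanish. -/
theorem eq_zero_of_linear_nonneg (b : AffineBasis (Fin 3) ℝ (Fin 2 → ℝ)) {w : Fin 2 → ℝ}
    (h : ∀ i, 0 ≤ (b.coord i).linear w) : w = 0 := by
  have hs := b.sum_coord_apply_eq_one w
  have h0 := b.sum_coord_apply_eq_one 0
  have key : ∀ i, b.coord i w = b.coord i 0 + (b.coord i).linear w := fun i => by
    simpa using coord_add b i 0 w
  simp only [Fin.sum_univ_three] at hs h0
  rw [key, key, key] at hs
  refine b.ext_elem fun i => ?_
  rw [key i]
  have := h 0
  have := h 1
  have := h 2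
  fin_cases i <;> simp only [Fin.reduceFinMk, Fin.zero_eta, Fin.mk_one] <;> linarith

/-- Points `y i` of the lattice inside the edges of the triangle with vertices `b` are its only
lattice points, and `f` lies in its interior. -/
structure Inscribed (f : Fin 2 → ℝ) (b : AffineBasis (Fin 3) ℝ (Fin 2 → ℝ))
    (y : Fin 3 → Fin 2 → ℝ) : Prop where
  pos : ∀ i, 0 < b.coord i f
  mem : ∀ i, y i ∈ lattice
  zero : ∀ i, b.coord i (y i) = 0
  coord_pos : ∀ i j, i ≠ j → 0 < b.coord j (y i)
  eq_of_mem : ∀ x ∈ lattice, (∀ i, 0 ≤ b.coord i x) → ∃ i, x = y i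

/-- Every row vanishes at `f`, so a row with value one at `x` would exceed one slightly beyond `x`
on the line from `f`. -/
theorem dotProduct_lt_one_of_mem_interior {f : Fin 2 → ℝ} {B : Matrix (Fin 3) (Fin 2) ℝ}
    {x : Fin 2 → ℝ} (hx : x ∈ interior (M f B)) (i : Fin 3) : B i ⬝ᵥ (x - f) < 1 := by
  have hle : B i ⬝ᵥ (x - f) ≤ 1 := interior_subset hx i
  have hc : ContinuousAt (fun t : ℝ => x + t • (x - f)) 0 := by fun_prop
  have h0 : ∀ᶠ t : ℝ in nhds 0, x + t • (x - f) ∈ M f B := by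
    apply hc
    simpa using mem_interior_iff_mem_nhds.1 hx
  obtain ⟨ε, hε, h⟩ := Metric.eventually_nhds_iff.1 h0
  have := h (y := ε / 2) (by rw [Real.dist_eq, sub_zero, abs_of_pos (by linarith)]; linarith) i
  have e : x + (ε / 2) • (x - f) - f = (1 + ε / 2) • (x - f) := by
    ext j; simp; ring
  rw [e, dotProduct_smul, smul_eq_mul] at this
  nlinarith

theorem mem_interior_of_dotProduct_lt_one {f : Fin 2 → ℝ} {B : Matrix (Fin 3) (Fin 2) ℝ}
    {x : Fin 2 → ℝ} (hx : ∀ i, B i ⬝ᵥ (x - f) < 1) : x ∈ interior (M f B) := by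
  have ho : IsOpen {x : Fin 2 → ℝ | ∀ i, B i ⬝ᵥ (x - f) < 1} := by
    simp only [ofPred_forall]
    refine isOpen_iInter_of_finite fun i => isOpen_lt ?_ continuous_const
    unfold dotProduct
    fun_prop
  exact interior_maximal (fun z hz i => (hz i).le) ho hx

theorem extremePoints_coord_nonneg (b : AffineBasis (Fin 3) ℝ (Fin 2 → ℝ)) :
    {x | ∀ i, 0 ≤ b.coord i x}.extremePoints ℝ = range b := by
  apply Subset.antisymm
  · rw [← b.convexHull_eq_nonneg_coord]
    exact extremePoints_convexHull_subset
  · rintro _ ⟨i, rfl⟩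
    rw [mem_extremePoints]
    have key : ∀ x₁ x₂ : Fin 2 → ℝ, (∀ i, 0 ≤ b.coord i x₁) → (∀ i, 0 ≤ b.coord i x₂) →
        b i ∈ openSegment ℝ x₁ x₂ → x₁ = b i := by
      rintro x₁ x₂ h₁ h₂ ⟨s, t, hs, ht, hst, hb⟩
      have hz : ∀ j, j ≠ i → b.coord j x₁ = 0 := by
        intro j hj
        have := Convex.combo_affine_apply (x := x₁) (y := x₂) (f := b.coord j) hst
        rw [hb, b.coord_apply_ne hj, smul_eq_mul, smul_eq_mul] at this
        nlinarith [h₁ j, h₂ j, mul_nonneg hs.le (h₁ j), mul_nonneg ht.le (h₂ j)]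
      refine b.ext_elem fun j => ?_
      by_cases hj : j = i
      · subst hj
        rw [b.coord_apply_eq, ← b.sum_coord_apply_eq_one x₁]
        exact (Finset.sum_eq_single j (fun k _ hk => hz k hk) (by simp)).symm
      · rw [hz j hj, b.coord_apply_ne hj]
    refine ⟨fun j => ?_, fun x₁ h₁ x₂ h₂ h => ⟨key x₁ x₂ h₁ h₂ h, key x₂ x₁ h₂ h₁ ?_⟩⟩
    · rw [b.coord_apply]; split_ifs <;> norm_num
    · rwa [openSegment_symm]

theorem IsType3Triangle.exists_inscribed {f : Fin 2 → ℝ} {B : Matrix (Fin 3) (Fin 2) ℝ}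
    (h : IsType3Triangle (M f B)) :
    ∃ (b : AffineBasis (Fin 3) ℝ (Fin 2 → ℝ)) (y : Fin 3 → Fin 2 → ℝ), Inscribed f b y ∧
      M f B = {x | ∀ i, 0 ≤ b.coord i x} := by
  obtain ⟨hmax, v, hv, hS, hcard, hedge⟩ := h
  have htop : affineSpan ℝ (range v) = ⊤ := by
    rw [hv.affineSpan_eq_top_iff_card_eq_finrank_add_one]; simp
  let b : AffineBasis (Fin 3) ℝ (Fin 2 → ℝ) := ⟨v, hv, htop⟩
  have hb : (b : Fin 3 → Fin 2 → ℝ) = v := rfl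
  have hM : M f B = {x | ∀ i, 0 ≤ b.coord i x} := by
    rw [hS, ← hb, b.convexHull_eq_nonneg_coord]
  have hint : interior (M f B) = {x | ∀ i, 0 < b.coord i x} := by
    rw [hS, ← hb, b.interior_convexHull]
  have hfree : interior (M f B) ∩ lattice = ∅ := hmax.prop.2
  have hex : ∀ i : Fin 3, ∃ y ∈ lattice, b.coord i y = 0 ∧ ∀ j, i ≠ j → 0 < b.coord j y := by
    intro i
    obtain ⟨y, ⟨⟨s, t, hs, ht, hst, hy⟩, hl⟩, -⟩ := hedge (i + 1) (i + 2) (by fin_cases i <;> decide)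
    have hc : ∀ j, b.coord j y = s * b.coord j (b (i + 1)) + t * b.coord j (b (i + 2)) := by
      intro j
      have := Convex.combo_affine_apply (x := v (i + 1)) (y := v (i + 2)) (f := b.coord j) hst
      rw [hy] at this
      simpa [hb] using this
    simp only [b.coord_apply] at hc
    refine ⟨y, hl, ?_, ?_⟩
    · rw [hc]; fin_cases i <;> simp
    · intro j hj
      rw [hc]
      fin_cases i <;> fin_cases j <;> simp_all
  choose y hy hy0 hypos using hex
  have hinj : Function.Injective y := by
    intro i j hij
    by_contra hne
    have := hypos i j hne
    rw [hij, hy0 j] at this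
    exact lt_irrefl _ this
  have hnot : ∀ x ∈ lattice, x ∉ interior (M f B) := fun x hx hi => by
    have : x ∈ interior (M f B) ∩ lattice := ⟨hi, hx⟩
    rw [hfree] at this
    exact this
  have hfr : ∀ x ∈ lattice, (∀ i, 0 ≤ b.coord i x) → x ∈ frontier (M f B) ∩ lattice := by
    intro x hx h0
    refine ⟨⟨subset_closure ?_, hnot x hx⟩, hx⟩
    rw [hM]; exact h0
  -- The three edge points are distinct and the boundary has exactly three lattice points, so there
  -- are no others.
  have hrange : range y = frontier (M f B) ∩ lattice := by
    apply eq_of_subset_of_ncard_le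
    · rintro _ ⟨i, rfl⟩
      refine hfr _ (hy i) fun j => ?_
      by_cases hj : i = j
      · subst hj; exact (hy0 i).ge
      · exact (hypos i j hj).le
    · rw [hcard, ← image_univ, ncard_image_of_injective _ hinj, ncard_univ]; simp
    · exact finite_of_ncard_ne_zero (by rw [hcard]; norm_num)
  refine ⟨b, y, ⟨?_, hy, hy0, hypos, ?_⟩, hM⟩
  · have : f ∈ interior (M f B) := mem_interior_of_dotProduct_lt_one fun i => by simp
    rw [hint] at this
    exact this
  · intro x hx h0
    have := hfr x hx h0
    rw [← hrange] at this
    obtain ⟨i, rfl⟩ := this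
    exact ⟨i, rfl⟩

/-! ### The edge functionals of a triangle around `f` -/

/-- The rows are the functionals equal to one on the edges of the triangle, seen from `f`. -/
noncomputable def edgeMatrix (f : Fin 2 → ℝ) (b : AffineBasis (Fin 3) ℝ (Fin 2 → ℝ)) :
    Matrix (Fin 3) (Fin 2) ℝ :=
  fun i j => -(b.coord i).linear (fun l => if j = l then 1 else 0) / b.coord i f

theorem edgeMatrix_dotProduct (f : Fin 2 → ℝ) (b : AffineBasis (Fin 3) ℝ (Fin 2 → ℝ)) (i : Fin 3)
    (w : Fin 2 → ℝ) : edgeMatrix f b i ⬝ᵥ w = -(b.coord i).linear w / b.coord i f := by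
  rw [LinearMap.pi_apply_eq_sum_univ (b.coord i).linear w]
  simp only [dotProduct, edgeMatrix, Fin.sum_univ_two, smul_eq_mul]
  ring

theorem Inscribed.dotProduct_sub {f : Fin 2 → ℝ} {b : AffineBasis (Fin 3) ℝ (Fin 2 → ℝ)}
    {y : Fin 3 → Fin 2 → ℝ} (h : Inscribed f b y) (i : Fin 3) (x : Fin 2 → ℝ) :
    edgeMatrix f b i ⬝ᵥ (x - f) = 1 - b.coord i x / b.coord i f := by
  have := (h.pos i).ne'
  rw [edgeMatrix_dotProduct, linear_sub]
  field_simp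
  ring

theorem Inscribed.M_edgeMatrix {f : Fin 2 → ℝ} {b : AffineBasis (Fin 3) ℝ (Fin 2 → ℝ)}
    {y : Fin 3 → Fin 2 → ℝ} (h : Inscribed f b y) :
    M f (edgeMatrix f b) = {x | ∀ i, 0 ≤ b.coord i x} := by
  ext x
  refine forall_congr' fun i => ?_
  rw [h.dotProduct_sub, sub_le_self_iff, le_div_iff₀ (h.pos i), zero_mul]

/-! ### The gauge `psi` -/

theorem psi_le_iff {B : Matrix (Fin 3) (Fin 2) ℝ} {r : Fin 2 → ℝ} {t : ℝ} :
    psi B r ≤ t ↔ ∀ i, B i ⬝ᵥ r ≤ t := by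
  simp [psi]

theorem le_psi (B : Matrix (Fin 3) (Fin 2) ℝ) (r : Fin 2 → ℝ) (i : Fin 3) :
    B i ⬝ᵥ r ≤ psi B r :=
  psi_le_iff.1 le_rfl i

theorem exists_eq_psi (B : Matrix (Fin 3) (Fin 2) ℝ) (r : Fin 2 → ℝ) :
    ∃ i, B i ⬝ᵥ r = psi B r := by
  obtain ⟨i, -, hi⟩ := Finset.exists_mem_eq_sup' (s := (Finset.univ : Finset (Fin 3)))
    Finset.univ_nonempty (fun i => B i ⬝ᵥ r)
  exact ⟨i, hi.symm⟩

theorem psi_zero (B : Matrix (Fin 3) (Fin 2) ℝ) : psi B 0 = 0 := by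
  obtain ⟨i, hi⟩ := exists_eq_psi B 0
  rw [← hi, dotProduct_zero]

theorem psi_le_iff_mem {f : Fin 2 → ℝ} {B : Matrix (Fin 3) (Fin 2) ℝ} {r : Fin 2 → ℝ} {t : ℝ}
    (ht : 0 < t) : psi B r ≤ t ↔ f + (1 / t) • r ∈ M f B := by
  rw [psi_le_iff]
  refine forall_congr' fun i => ?_
  rw [add_sub_cancel_left, dotProduct_smul, smul_eq_mul, one_div, inv_mul_le_one₀ ht]

theorem Inscribed.psi_edgeMatrix_pos {f : Fin 2 → ℝ} {b : AffineBasis (Fin 3) ℝ (Fin 2 → ℝ)}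
    {y : Fin 3 → Fin 2 → ℝ} (h : Inscribed f b y) {r : Fin 2 → ℝ} (hr : r ≠ 0) :
    0 < psi (edgeMatrix f b) r := by
  by_contra hle
  rw [not_lt, psi_le_iff] at hle
  refine hr (eq_zero_of_linear_nonneg b fun i => ?_)
  have := hle i
  rw [edgeMatrix_dotProduct, div_le_iff₀ (h.pos i)] at this
  linarith

/-- For `t > 0` the condition `psi B r ≤ t` depends on the set `M f B` alone. Hence `B`, whose rows
come in no prescribed order, may be replaced by the edge matrix. -/
theorem Inscribed.psi_eq {f : Fin 2 → ℝ} {b : AffineBasis (Fin 3) ℝ (Fin 2 → ℝ)}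
    {y : Fin 3 → Fin 2 → ℝ} (h : Inscribed f b y) {B : Matrix (Fin 3) (Fin 2) ℝ}
    (hB : M f B = {x | ∀ i, 0 ≤ b.coord i x}) : psi B = psi (edgeMatrix f b) := by
  funext r
  by_cases hr : r = 0
  · rw [hr, psi_zero, psi_zero]
  have key : ∀ t : ℝ, 0 < t → (psi B r ≤ t ↔ psi (edgeMatrix f b) r ≤ t) := fun t ht => by
    rw [psi_le_iff_mem ht (f := f), psi_le_iff_mem ht (f := f), hB, h.M_edgeMatrix]
  have hpos := h.psi_edgeMatrix_pos hr
  refine le_antisymm ((key _ hpos).2 le_rfl) ?_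
  by_contra hlt
  rw [not_le] at hlt
  -- The sign of `psi B r` is not yet known; the maximum is a positive level still below `psi
  -- (edgeMatrix f b) r`.
  have hm : 0 < max (psi B r) (psi (edgeMatrix f b) r / 2) := lt_max_of_lt_right (by linarith)
  have := (key _ hm).1 (le_max_left _ _)
  rcases le_max_iff.1 this with h' | h' <;> linarith

theorem mem_lattice_add {x y : Fin 2 → ℝ} (hx : x ∈ lattice) (hy : y ∈ lattice) :
    x + y ∈ lattice := fun i => by
  obtain ⟨m, hm⟩ := hx i
  obtain ⟨n, hn⟩ := hy i
  exact ⟨m + n, by simp [hm, hn]⟩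

theorem mem_lattice_sub {x y : Fin 2 → ℝ} (hx : x ∈ lattice) (hy : y ∈ lattice) :
    x - y ∈ lattice := fun i => by
  obtain ⟨m, hm⟩ := hx i
  obtain ⟨n, hn⟩ := hy i
  exact ⟨m - n, by simp [hm, hn]⟩

section Tilting

/-! ### Tilting a triangle about its lattice points -/

variable {f : Fin 2 → ℝ} {b : AffineBasis (Fin 3) ℝ (Fin 2 → ℝ)} {y : Fin 3 → Fin 2 → ℝ}

/-- The planar determinant. -/
def cross (v w : Fin 2 → ℝ) : ℝ := v 0 * w 1 - v 1 * w 0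

theorem cross_smul_eq (v w : Fin 2 → ℝ) (h : cross v w = 0) (hv : v ≠ 0) : ∃ t : ℝ, w = t • v := by
  unfold cross at h
  by_cases h0 : v 0 = 0
  · have h1 : v 1 ≠ 0 := fun h1 => hv (by ext i; fin_cases i <;> simpa)
    refine ⟨w 1 / v 1, ?_⟩
    ext i
    fin_cases i
    · simp_all
    · simp [h1]
  · refine ⟨w 0 / v 0, ?_⟩
    ext i
    fin_cases i
    · simp [h0]
    · simp; field_simp; linarith

/-- The point `f` is off the line of edge `i`, so the line through `f` and `y i` meets it only once.
-/
theorem Inscribed.eq_of_cross_eq_zero (h : Inscribed f b y) {i : Fin 3} {x : Fin 2 → ℝ}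
    (hx : b.coord i x = 0) (hc : cross (y i - f) (x - f) = 0) : x = y i := by
  have hp := h.pos i
  have hlin : (b.coord i).linear (y i - f) = -b.coord i f := by
    rw [linear_sub, h.zero, zero_sub]
  obtain ⟨t, ht⟩ := cross_smul_eq _ _ hc fun h0 => by
    rw [h0, map_zero] at hlin
    linarith
  have : (b.coord i).linear (x - f) = -b.coord i f := by
    rw [linear_sub, hx, zero_sub]
  rw [ht, map_smul, hlin, smul_eq_mul] at this
  have ht1 : t = 1 := by
    have : (t - 1) * b.coord i f = 0 := by linarith
    rcases mul_eq_zero.1 this with h' | h' <;> linarith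
  rw [ht1, one_smul] at ht
  exact sub_left_injective ht

theorem Inscribed.vertex_ne (h : Inscribed f b y) {i j : Fin 3} (hij : i ≠ j) : b j ≠ y i := by
  have third : ∀ i j : Fin 3, i ≠ j → ∃ k : Fin 3, i ≠ k ∧ k ≠ j := by decide
  intro e
  obtain ⟨k, hk, hkj⟩ := third i j hij
  have := h.coord_pos i k hk
  rw [← e, b.coord_apply_ne hkj] at this
  exact lt_irrefl _ this

/-- Tilt directions are multiples of `y i - f` turned by a right angle. Equal rates at two vertices
are two linear conditions on three scales, and they have a solution with all scales nonzero. -/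
theorem Inscribed.exists_tilt (h : Inscribed f b y) (m : Fin 3) :
    ∃ T : Matrix (Fin 3) (Fin 2) ℝ, (∀ i, T i ⬝ᵥ (y i - f) = 0) ∧
      (∀ i x, b.coord i x = 0 → T i ⬝ᵥ (x - f) = 0 → x = y i) ∧
      ∀ j, j ≠ m → ∀ i i', i ≠ j → i' ≠ j → T i ⬝ᵥ (b j - f) = T i' ⬝ᵥ (b j - f) := by
  have hne : ∀ i j, i ≠ j → cross (y i - f) (b j - f) ≠ 0 := fun i j hij hc =>
    h.vertex_ne hij (h.eq_of_cross_eq_zero (b.coord_apply_ne hij) hc)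
  -- In `Fin 3` the index `-(i + m)` is the one other than `i` and `m`, so it names the common
  -- vertex of edges `i` and `m`; the quotient makes their rates agree there.
  let θ : Fin 3 → ℝ := fun i => if i = m then 1 else
    cross (y m - f) (b (-(i + m)) - f) / cross (y i - f) (b (-(i + m)) - f)
  have third : ∀ i m : Fin 3, i ≠ m →
      m ≠ -(i + m) ∧ i ≠ -(i + m) ∧ ∀ j, j ≠ m → i ≠ j → -(i + m) = j := by decide
  have hθ : ∀ i, θ i ≠ 0 := by
    intro i
    by_cases him : i = m
    · simp [θ, him]
    · simp only [θ, him, if_false]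
      exact div_ne_zero (hne _ _ (third i m him).1) (hne _ _ (third i m him).2.1)
  let T : Matrix (Fin 3) (Fin 2) ℝ := fun i => ![-(θ i * (y i - f) 1), θ i * (y i - f) 0]
  have hT : ∀ i w, T i ⬝ᵥ w = θ i * cross (y i - f) w := by
    intro i w
    simp [T, cross, dotProduct, Fin.sum_univ_two]
    ring
  have hTm : ∀ i j, j ≠ m → i ≠ j → T i ⬝ᵥ (b j - f) = cross (y m - f) (b j - f) := by
    intro i j hjm hij
    rw [hT]
    by_cases him : i = m
    · simp [θ, him]
    · have hj : -(i + m) = j := (third i m him).2.2 j hjm hij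
      simp only [θ, him, if_false, hj]
      exact div_mul_cancel₀ _ (hne i j hij)
  refine ⟨T, fun i => ?_, fun i x hx h0 => ?_, fun j hj i i' hi hi' => ?_⟩
  · rw [hT, cross]; ring
  · rw [hT] at h0
    exact h.eq_of_cross_eq_zero hx ((mul_eq_zero.1 h0).resolve_left (hθ i))
  · rw [hTm i j hj hi, hTm i' j hj hi']

open Filter Topology

theorem tilt_apply (C T : Matrix (Fin 3) (Fin 2) ℝ) (ε : ℝ) (i : Fin 3) (w : Fin 2 → ℝ) :
    (C + ε • T) i ⬝ᵥ w = C i ⬝ᵥ w + ε * (T i ⬝ᵥ w) := by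
  have : (C + ε • T) i = C i + ε • T i := rfl
  rw [this, add_dotProduct, smul_dotProduct, smul_eq_mul]

/-- A common derivative of the active functionals makes `psi` affine along a small segment. -/
theorem eventually_psi_tilt (C T : Matrix (Fin 3) (Fin 2) ℝ) (r : Fin 2 → ℝ) (d : ℝ)
    (hd : ∀ i, C i ⬝ᵥ r = psi C r → T i ⬝ᵥ r = d) :
    ∀ᶠ ε : ℝ in 𝓝 0, psi (C + ε • T) r = psi C r + ε * d := by
  have hall : ∀ i, ∀ᶠ ε : ℝ in 𝓝 0, (C + ε • T) i ⬝ᵥ r ≤ psi C r + ε * d := by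
    intro i
    simp only [tilt_apply]
    rcases (le_psi C r i).eq_or_lt with hi | hi
    · exact Eventually.of_forall fun ε => by rw [hi, hd i hi]
    · have hc : ContinuousAt (fun ε : ℝ => psi C r + ε * d - (C i ⬝ᵥ r + ε * (T i ⬝ᵥ r))) 0 := by
        fun_prop
      filter_upwards [hc.eventually (lt_mem_nhds (a := 0) (by simpa using hi))] with ε hε
      linarith
  filter_upwards [eventually_all.2 hall] with ε hε
  refine le_antisymm (psi_le_iff.2 hε) ?_
  obtain ⟨i, hi⟩ := exists_eq_psi C r
  rw [← hi, ← hd i hi, ← tilt_apply]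
  exact le_psi _ _ i

/-! ### Lattice-freeness under small tilts. -/

theorem finite_lattice_inter_bounded {S : Set (Fin 2 → ℝ)} (hS : Bornology.IsBounded S) :
    (S ∩ lattice).Finite := by
  obtain ⟨R, hR⟩ := hS.subset_closedBall 0
  have hfin : (range fun p : (Finset.Icc (-⌈R⌉) ⌈R⌉) × (Finset.Icc (-⌈R⌉) ⌈R⌉) =>
      (![((p.1 : ℤ) : ℝ), ((p.2 : ℤ) : ℝ)] : Fin 2 → ℝ)).Finite := finite_range _
  refine hfin.subset ?_
  rintro x ⟨hx, hl⟩
  obtain ⟨a, ha⟩ := hl 0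
  obtain ⟨c, hc⟩ := hl 1
  have hn : ‖x‖ ≤ R := by simpa using hR hx
  have hm : ∀ z : ℤ, ‖(z : ℝ)‖ ≤ R → z ∈ Finset.Icc (-⌈R⌉) ⌈R⌉ := by
    intro z hz
    rw [Real.norm_eq_abs, abs_le] at hz
    have hR := Int.le_ceil R
    rw [Finset.mem_Icc]
    constructor
    · have : ((-⌈R⌉ : ℤ) : ℝ) ≤ z := by push_cast; linarith
      exact_mod_cast this
    · have : (z : ℝ) ≤ (⌈R⌉ : ℤ) := by linarith
      exact_mod_cast this
  refine ⟨(⟨a, hm a ?_⟩, ⟨c, hm c ?_⟩), ?_⟩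
  · rw [← ha]; exact (norm_le_pi_norm x 0).trans hn
  · rw [← hc]; exact (norm_le_pi_norm x 1).trans hn
  · ext i; fin_cases i <;> simp [ha, hc]

theorem abs_dotProduct_le (v w : Fin 2 → ℝ) : |v ⬝ᵥ w| ≤ 2 * ‖v‖ * ‖w‖ := by
  simp only [dotProduct, Fin.sum_univ_two]
  have h : ∀ i, |v i * w i| ≤ ‖v‖ * ‖w‖ := fun i => by
    rw [abs_mul]
    exact mul_le_mul (norm_le_pi_norm v i) (norm_le_pi_norm w i) (abs_nonneg _) (norm_nonneg _)
  have := abs_add_le (v 0 * w 0) (v 1 * w 1)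
  linarith [h 0, h 1]

/-- The gauge dominates a multiple of the norm. -/
theorem exists_norm_le_psi (C : Matrix (Fin 3) (Fin 2) ℝ) (hC : ∀ r, r ≠ 0 → 0 < psi C r) :
    ∃ c > 0, ∀ r, c * ‖r‖ ≤ psi C r := by
  have hcont : Continuous (psi C) := by
    unfold psi dotProduct
    refine Continuous.finset_sup'_apply _ fun i _ => ?_
    fun_prop
  have hcomp : IsCompact (Metric.sphere (0 : Fin 2 → ℝ) 1) := isCompact_sphere 0 1
  have hne : (Metric.sphere (0 : Fin 2 → ℝ) 1).Nonempty := NormedSpace.sphere_nonempty.2 zero_le_one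
  obtain ⟨u, hu, hmin⟩ := hcomp.exists_isMinOn hne hcont.continuousOn
  have hu0 : u ≠ 0 := by
    rintro rfl
    simp at hu
  refine ⟨psi C u, hC u hu0, fun r => ?_⟩
  by_cases hr : r = 0
  · rw [hr, psi_zero, norm_zero, mul_zero]
  have hr' : 0 < ‖r‖ := norm_pos_iff.2 hr
  have hs : ‖r‖⁻¹ • r ∈ Metric.sphere (0 : Fin 2 → ℝ) 1 := by
    rw [mem_sphere_zero_iff_norm, norm_smul, norm_inv, norm_norm, inv_mul_cancel₀ hr'.ne']
  obtain ⟨i, hi⟩ := exists_eq_psi C (‖r‖⁻¹ • r)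
  have h1 : psi C u ≤ psi C (‖r‖⁻¹ • r) := hmin hs
  rw [← hi, dotProduct_smul, smul_eq_mul, inv_mul_eq_div, le_div_iff₀ hr'] at h1
  exact h1.trans (le_psi C r i)

theorem Inscribed.eventually_latticeFree (h : Inscribed f b y) {T : Matrix (Fin 3) (Fin 2) ℝ}
    (hT : ∀ i, T i ⬝ᵥ (y i - f) = 0) :
    ∀ᶠ ε : ℝ in 𝓝 0, LatticeFree (M f (edgeMatrix f b + ε • T)) := by
  set C := edgeMatrix f b with hC
  obtain ⟨c, hc, hcle⟩ := exists_norm_le_psi C fun r hr => h.psi_edgeMatrix_pos hr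
  have hsmall : ∀ i, ∀ᶠ ε : ℝ in 𝓝 0, |ε| * (2 * ‖T i‖) < c / 2 := by
    intro i
    have hcont : ContinuousAt (fun ε : ℝ => |ε| * (2 * ‖T i‖)) 0 := by fun_prop
    exact hcont.eventually_lt continuousAt_const (by simpa using half_pos hc)
  have hfin := finite_lattice_inter_bounded (Metric.isBounded_closedBall (x := f) (r := 2 / c))
  have hpt : ∀ x ∈ Metric.closedBall f (2 / c) ∩ lattice,
      ∀ᶠ ε : ℝ in 𝓝 0, ∃ i, 1 ≤ (C + ε • T) i ⬝ᵥ (x - f) := by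
    rintro x ⟨-, hx⟩
    simp only [tilt_apply]
    -- A lattice point in the triangle is a pivot and keeps row value one; one outside violates some
    -- row strictly, which persists for small `ε`.
    by_cases hin : ∀ i, 0 ≤ b.coord i x
    · obtain ⟨i, rfl⟩ := h.eq_of_mem x hx hin
      refine Eventually.of_forall fun ε => ⟨i, ?_⟩
      rw [hT, h.dotProduct_sub, h.zero]
      simp
    · push Not at hin
      obtain ⟨i, hi⟩ := hin
      have h1 : 1 < C i ⬝ᵥ (x - f) := by
        rw [h.dotProduct_sub]
        have := div_neg_of_neg_of_pos hi (h.pos i)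
        linarith
      have hcont : ContinuousAt (fun ε : ℝ => C i ⬝ᵥ (x - f) + ε * (T i ⬝ᵥ (x - f))) 0 := by
        fun_prop
      filter_upwards [hcont.eventually (lt_mem_nhds (a := 1) (by simpa using h1))] with ε hε
      exact ⟨i, hε.le⟩
  filter_upwards [eventually_all.2 hsmall, hfin.eventually_all.2 hpt] with ε hε hx
  rw [LatticeFree, eq_empty_iff_forall_notMem]
  rintro x ⟨hxi, hxl⟩
  have hlt := dotProduct_lt_one_of_mem_interior hxi
  -- The tilt changes each row by at most `c / 2` times the norm, while some row of `C` is at least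
  -- `c` times the norm, so the interior stays in the ball of radius `2 / c`.
  have hball : x ∈ Metric.closedBall f (2 / c) := by
    rw [mem_closedBall_iff_norm, le_div_iff₀ hc]
    obtain ⟨i, hi⟩ := exists_eq_psi C (x - f)
    have h1 := hcle (x - f)
    have h2 := hlt i
    rw [tilt_apply] at h2
    have h3 : |ε * (T i ⬝ᵥ (x - f))| ≤ c / 2 * ‖x - f‖ := by
      rw [abs_mul]
      calc |ε| * |T i ⬝ᵥ (x - f)| ≤ |ε| * (2 * ‖T i‖ * ‖x - f‖) :=
            mul_le_mul_of_nonneg_left (abs_dotProduct_le _ _) (abs_nonneg _)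
        _ = |ε| * (2 * ‖T i‖) * ‖x - f‖ := by ring
        _ ≤ _ := mul_le_mul_of_nonneg_right (hε i).le (norm_nonneg _)
    have h4 := (abs_le.1 h3).1
    linarith
  obtain ⟨i, hi⟩ := hx x ⟨hball, hxl⟩
  exact absurd (hlt i) (not_lt.2 hi)

theorem Inscribed.exists_strictConvexCombination {k : ℕ} (h : Inscribed f b y)
    (r : Fin k → Fin 2 → ℝ) {m : Fin 3}
    (hm : b m ∉ rayIntersections f (edgeMatrix f b) (range r))
    (hR : ¬ rayIntersections f (edgeMatrix f b) (range r) ⊆ lattice) :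
    ∃ γ₁ ∈ Delta f r, ∃ γ₂ ∈ Delta f r,
      IsStrictConvexCombination (gam r (edgeMatrix f b)) γ₁ γ₂ := by
  obtain ⟨T, hT0, hTne, hTv⟩ := h.exists_tilt m
  have hfree := h.eventually_latticeFree hT0
  set C := edgeMatrix f b with hC
  have hcoord : ∀ w, 0 < psi C w → ∀ i, C i ⬝ᵥ w = psi C w →
      b.coord i (f + (1 / psi C w) • w) = 0 := by
    intro w hw i hi
    have h1 := h.dotProduct_sub i (f + (1 / psi C w) • w)
    rw [add_sub_cancel_left, dotProduct_smul, hi, smul_eq_mul, one_div_mul_cancel hw.ne'] at h1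
    have h2 : b.coord i (f + (1 / psi C w) • w) / b.coord i f = 0 := by linarith
    exact (div_eq_zero_iff.1 h2).resolve_right (h.pos i).ne'
  have hd : ∀ j, ∃ d, ∀ i, C i ⬝ᵥ r j = psi C (r j) → T i ⬝ᵥ r j = d := by
    intro j
    by_cases hr : r j = 0
    · exact ⟨0, fun i _ => by rw [hr, dotProduct_zero]⟩
    have hpos := h.psi_edgeMatrix_pos hr
    obtain ⟨i₀, hi₀⟩ := exists_eq_psi C (r j)
    refine ⟨T i₀ ⬝ᵥ r j, fun i hi => ?_⟩
    by_cases hii : i = i₀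
    · rw [hii]
    -- Two distinct active edges meet in a vertex `b l`. As this is a ray intersection, `l ≠ m`, and
    -- there the rates agree by the choice of the tilt.
    have hl : ∃ l : Fin 3, i ≠ l ∧ i₀ ≠ l ∧ ∀ a, a ≠ l → a = i ∨ a = i₀ := by
      clear hi hi₀
      revert i i₀; decide
    obtain ⟨l, hil, hi₀l, hl⟩ := hl
    have hp : f + (1 / psi C (r j)) • r j = b l := by
      have hz : ∀ a, a ≠ l → b.coord a (f + (1 / psi C (r j)) • r j) = 0 := by
        intro a ha
        rcases hl a ha with rfl | rfl
        · exact hcoord _ hpos _ hi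
        · exact hcoord _ hpos _ hi₀
      refine b.ext_elem fun a => ?_
      by_cases ha : a = l
      · subst ha
        rw [b.coord_apply_eq]
        exact (Finset.sum_eq_single a (fun c _ hc => hz c hc)
          (fun hn => absurd (Finset.mem_univ _) hn)).symm.trans
          (b.sum_coord_apply_eq_one _)
      · rw [hz a ha, b.coord_apply_ne ha]
    have hlm : l ≠ m := by
      rintro rfl
      exact hm ⟨r j, mem_range_self j, hpos, hp.symm⟩
    have := hTv l hlm i i₀ hil hi₀l
    rw [← hp, add_sub_cancel_left, dotProduct_smul, dotProduct_smul, smul_eq_mul, smul_eq_mul] at this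
    exact mul_left_cancel₀ (one_div_pos.2 hpos).ne' this
  choose d hd using hd
  have hpsi : ∀ᶠ ε : ℝ in 𝓝 0, ∀ j, psi (C + ε • T) (r j) = psi C (r j) + ε * d j :=
    eventually_all.2 fun j => eventually_psi_tilt C T (r j) (d j) (hd j)
  obtain ⟨δ, hδ, hall⟩ := Metric.eventually_nhds_iff.1 (hfree.and hpsi)
  have hplus := hall (y := δ / 2) (by
    rw [Real.dist_eq, sub_zero, abs_of_pos (by linarith)]; linarith)
  have hminus := hall (y := -(δ / 2)) (by
    rw [Real.dist_eq, sub_zero, abs_neg, abs_of_pos (by linarith)]; linarith)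
  refine ⟨_, ⟨_, hplus.1, rfl⟩, _, ⟨_, hminus.1, rfl⟩, fun heq => ?_, ?_⟩
  -- At a nonintegral ray intersection the rate `d j` cannot vanish, since on edge `i` the tilt
  -- vanishes only at the lattice point `y i`.
  · obtain ⟨p, ⟨_, ⟨j, rfl⟩, hpos, rfl⟩, hp⟩ := not_subset.1 hR
    have := congrFun heq j
    simp only [gam, hplus.2 j, hminus.2 j] at this
    have hdj : d j = 0 := by
      have : δ * d j = 0 := by linarith
      exact (mul_eq_zero.1 this).resolve_left hδ.ne'
    obtain ⟨i, hi⟩ := exists_eq_psi C (r j)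
    have hy := hTne i _ (hcoord _ hpos i hi) (by
      rw [add_sub_cancel_left, dotProduct_smul, hd j i hi, hdj, smul_zero])
    exact hp (hy ▸ h.mem i)
  · ext j
    simp only [gam, Pi.smul_apply, Pi.add_apply, hplus.2 j, hminus.2 j, smul_eq_mul]
    ring

end Tilting

/-! ### Triangles with three corner rays -/

/-- The vertices of the triangle `b` lie on the rays `r (j i)`, at the points with gauge value one
for the values `s i`; the lattice point `y i` of the edge opposite to `b i` has the coordinates
`α i`, `β i` in the cone spanned by the rays of this edge. -/
structure CornerData {k : ℕ} (f : Fin 2 → ℝ) (r : Fin k → Fin 2 → ℝ)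
    (b : AffineBasis (Fin 3) ℝ (Fin 2 → ℝ)) (y : Fin 3 → Fin 2 → ℝ) (j : Fin 3 → Fin k)
    (s α β : Fin 3 → ℝ) : Prop extends Inscribed f b y where
  s_pos : ∀ i, 0 < s i
  vertex : ∀ i, b i = f + (1 / s i) • r (j i)
  α_pos : ∀ i, 0 < α i
  β_pos : ∀ i, 0 < β i
  point : ∀ i, y i = f + α i • r (j (i + 1)) + β i • r (j (i + 2))
  edge : ∀ i, α i * s (i + 1) + β i * s (i + 2) = 1

section

variable {k : ℕ} {f : Fin 2 → ℝ} {r : Fin k → Fin 2 → ℝ}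
  {b : AffineBasis (Fin 3) ℝ (Fin 2 → ℝ)} {y : Fin 3 → Fin 2 → ℝ} {j : Fin 3 → Fin k}
  {s α β : Fin 3 → ℝ}

theorem linear_ray {i : Fin 3} (hs : 0 < s i) (hv : b i = f + (1 / s i) • r (j i)) (l : Fin 3) :
    (b.coord l).linear (r (j i)) = s i * ((if l = i then 1 else 0) - b.coord l f) := by
  have h1 : r (j i) = s i • (b i - f) := by
    rw [hv, add_sub_cancel_left, smul_smul, mul_one_div_cancel hs.ne', one_smul]
  rw [h1, map_smul, linear_sub, b.coord_apply, smul_eq_mul]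

theorem Inscribed.exists_cornerData (h : Inscribed f b y) {B : Matrix (Fin 3) (Fin 2) ℝ}
    (hB : range b ⊆ rayIntersections f B (range r)) :
    ∃ j s α β, CornerData f r b y j s α β := by
  have hex : ∀ i, ∃ (n : Fin k) (t : ℝ), 0 < t ∧ b i = f + (1 / t) • r n := by
    intro i
    obtain ⟨_, ⟨n, rfl⟩, hpos, hb⟩ := hB (mem_range_self i)
    exact ⟨n, _, hpos, hb⟩
  choose j s hs hv using hex
  have ne : ∀ i : Fin 3, i ≠ i + 1 ∧ i ≠ i + 2 := by decide
  have hsum : ∀ i, b.coord (i + 1) (y i) + b.coord (i + 2) (y i) = 1 := by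
    intro i
    have h1 := b.sum_coord_apply_eq_one (y i)
    have h0 := h.zero i
    rw [Fin.sum_univ_three] at h1
    fin_cases i <;> simp at h0 h1 ⊢ <;> linarith
  -- The point `y i` is a convex combination of `b (i + 1)` and `b (i + 2)`; dividing its weights by
  -- the gauge values rewrites it in terms of the rays.
  refine ⟨j, s, fun i => b.coord (i + 1) (y i) / s (i + 1),
    fun i => b.coord (i + 2) (y i) / s (i + 2), ⟨h, hs, hv,
    fun i => div_pos (h.coord_pos _ _ (ne i).1) (hs _),
    fun i => div_pos (h.coord_pos _ _ (ne i).2) (hs _), fun i => ?_, fun i => ?_⟩⟩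
  · refine b.ext_elem fun l => ?_
    have h1 := (hs (i + 1)).ne'
    have h2 := (hs (i + 2)).ne'
    rw [coord_add, coord_add, map_smul, map_smul, linear_ray (hs _) (hv _),
      linear_ray (hs _) (hv _), smul_eq_mul, smul_eq_mul, ← mul_assoc, ← mul_assoc,
      div_mul_cancel₀ _ h1, div_mul_cancel₀ _ h2]
    have hl : b.coord l (y i) = b.coord (i + 1) (y i) * (if l = i + 1 then 1 else 0) +
        b.coord (i + 2) (y i) * (if l = i + 2 then 1 else 0) := by
      have h0 := h.zero i
      fin_cases i <;> fin_cases l <;> simp_all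
    rw [hl]
    linear_combination b.coord l f * hsum i
  · rw [div_mul_cancel₀ _ (hs _).ne', div_mul_cancel₀ _ (hs _).ne', hsum]

namespace CornerData

theorem coord_cone (h : CornerData f r b y j s α β) (p q l : Fin 3) (a c : ℝ) :
    b.coord l (f + a • r (j p) + c • r (j q)) = (1 - (a * s p + c * s q)) * b.coord l f +
      (a * s p * (if l = p then 1 else 0) + c * s q * (if l = q then 1 else 0)) := by
  rw [coord_add, coord_add, map_smul, map_smul, linear_ray (h.s_pos _) (h.vertex _),
    linear_ray (h.s_pos _) (h.vertex _), smul_eq_mul, smul_eq_mul]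
  ring

/-- The point `y i` is the unique lattice point of its cone that minimizes the edge functional. -/
theorem one_lt (h : CornerData f r b y j s α β) {i : Fin 3} {a c : ℝ} (ha : 0 ≤ a) (hc : 0 ≤ c)
    (hl : f + a • r (j (i + 1)) + c • r (j (i + 2)) ∈ lattice)
    (hne : f + a • r (j (i + 1)) + c • r (j (i + 2)) ≠ y i) :
    1 < a * s (i + 1) + c * s (i + 2) := by
  by_contra hle
  rw [not_lt] at hle
  have h1 := mul_nonneg ha (h.s_pos (i + 1)).le
  have h2 := mul_nonneg hc (h.s_pos (i + 2)).le
  have hnn : ∀ l : Fin 3, 0 ≤ a * s (i + 1) * (if l = i + 1 then (1 : ℝ) else 0) +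
      c * s (i + 2) * (if l = i + 2 then 1 else 0) := fun l => by
    apply add_nonneg <;> apply mul_nonneg
    · exact h1
    · split_ifs <;> norm_num
    · exact h2
    · split_ifs <;> norm_num
  have hco := h.coord_cone (i + 1) (i + 2)
  obtain ⟨n, hn⟩ := h.eq_of_mem _ hl fun l => by
    rw [hco]
    exact add_nonneg (mul_nonneg (by linarith) (h.pos l).le) (hnn l)
  by_cases hni : n = i
  · exact hne (hni ▸ hn)
  -- The point would be `y n` with `n ≠ i`. Its vanishing coordinate `n` forces the functional to
  -- equal one, which puts it on edge `i`, where `y n` does not lie.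
  have hz := hco n a c
  rw [hn, h.zero] at hz
  have hpn := h.pos n
  have h0 : (1 - (a * s (i + 1) + c * s (i + 2))) = 0 := by
    have := mul_nonneg (sub_nonneg.2 hle) hpn.le
    have h' : (1 - (a * s (i + 1) + c * s (i + 2))) * b.coord n f = 0 := by linarith [hnn n]
    exact (mul_eq_zero.1 h').resolve_right hpn.ne'
  have ne : ∀ i : Fin 3, i ≠ i + 1 ∧ i ≠ i + 2 := by decide
  have hi := hco i a c
  rw [hn, h0, if_neg (ne i).1, if_neg (ne i).2] at hi
  have := h.coord_pos n i hni
  linarith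

theorem linearIndependent_rays (h : CornerData f r b y j s α β) {p q : Fin 3} (hpq : p ≠ q)
    {a c : ℝ} (h0 : a • r (j p) + c • r (j q) = 0) : a = 0 ∧ c = 0 := by
  have third : ∀ p q : Fin 3, p ≠ q → ∃ l, l ≠ p ∧ l ≠ q := by decide
  obtain ⟨l, hlp, hlq⟩ := third p q hpq
  have hco : ∀ l, (1 - (a * s p + c * s q)) * b.coord l f +
      (a * s p * (if l = p then 1 else 0) + c * s q * (if l = q then 1 else 0)) =
        b.coord l f := fun l => by
    rw [← h.coord_cone, add_assoc, h0, add_zero]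
  have hl := hco l
  rw [if_neg hlp, if_neg hlq] at hl
  have hsum : a * s p + c * s q = 0 := by
    have : (a * s p + c * s q) * b.coord l f = 0 := by linarith
    exact (mul_eq_zero.1 this).resolve_right (h.pos l).ne'
  have hp := hco p
  rw [hsum, if_pos rfl, if_neg hpq] at hp
  have ha : a * s p = 0 := by linarith
  have hc : c * s q = 0 := by linarith
  exact ⟨(mul_eq_zero.1 ha).resolve_right (h.s_pos p).ne',
    (mul_eq_zero.1 hc).resolve_right (h.s_pos q).ne'⟩

theorem cross_ne_zero (h : CornerData f r b y j s α β) {p q : Fin 3} (hpq : p ≠ q) :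
    cross (r (j p)) (r (j q)) ≠ 0 := by
  intro hc
  by_cases hr : r (j p) = 0
  · have := (h.linearIndependent_rays hpq (a := 1) (c := 0) (by simp [hr])).1
    norm_num at this
  · obtain ⟨t, ht⟩ := cross_smul_eq _ _ hc hr
    have := (h.linearIndependent_rays hpq (a := t) (c := -1) (by rw [ht]; module)).2
    norm_num at this

end CornerData

/-! ### Recovering the triangle from dyadic sizes. -/

theorem lt_two_mul_of_log_eq {x z : ℝ} (hz : 0 < z) (h : Int.log 2 x = Int.log 2 z) :
    x < 2 * z := by
  have h1 := Int.lt_zpow_succ_log_self (b := 2) one_lt_two x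
  have h2 := Int.zpow_log_le_self (b := 2) one_lt_two hz
  rw [h, zpow_add_one₀ (by norm_num)] at h1
  push_cast at h1 h2
  linarith

/-- A cyclic system of equations with positive coefficients has only one solution. -/
theorem eq_of_cyclic {α β s s' : Fin 3 → ℝ} (hα : ∀ i, 0 < α i) (hβ : ∀ i, 0 < β i)
    (h : ∀ i, α i * s (i + 1) + β i * s (i + 2) = α i * s' (i + 1) + β i * s' (i + 2)) :
    s = s' := by
  -- This is the determinant of the system up to sign; the multipliers below are cofactors.
  have hd : 0 < α 0 * α 1 * α 2 + β 0 * β 1 * β 2 :=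
    add_pos (mul_pos (mul_pos (hα 0) (hα 1)) (hα 2)) (mul_pos (mul_pos (hβ 0) (hβ 1)) (hβ 2))
  have h0 : α 0 * s 1 + β 0 * s 2 = α 0 * s' 1 + β 0 * s' 2 := h 0
  have h1 : α 1 * s 2 + β 1 * s 0 = α 1 * s' 2 + β 1 * s' 0 := h 1
  have h2 : α 2 * s 0 + β 2 * s 1 = α 2 * s' 0 + β 2 * s' 1 := h 2
  funext i
  apply mul_left_cancel₀ hd.ne'
  fin_cases i
  · simp only [Fin.zero_eta]
    linear_combination (α 0 * α 1) * h2 - (α 1 * β 2) * h0 + (β 0 * β 2) * h1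
  · simp only [Fin.mk_one]
    linear_combination (α 1 * α 2) * h0 - (α 2 * β 0) * h1 + (β 0 * β 1) * h2
  · simp only [Fin.reduceFinMk]
    linear_combination (α 0 * α 2) * h1 - (α 0 * β 1) * h2 + (β 1 * β 2) * h0

/-- The rays and the dyadic sizes of the cone coordinates determine the triangle. -/
theorem CornerData.eq_of_log_eq (h : CornerData f r b y j s α β)
    {b' : AffineBasis (Fin 3) ℝ (Fin 2 → ℝ)} {y' : Fin 3 → Fin 2 → ℝ} {s' α' β' : Fin 3 → ℝ}
    (h' : CornerData f r b' y' j s' α' β') (hα : ∀ i, Int.log 2 (α i) = Int.log 2 (α' i))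
    (hβ : ∀ i, Int.log 2 (β i) = Int.log 2 (β' i)) : (b : Fin 3 → Fin 2 → ℝ) = b' := by
  have ne : ∀ i : Fin 3, i + 1 ≠ i + 2 := by decide
  have hy : ∀ i, y' i = y i := by
    intro i
    by_contra hne
    have h1 := h.one_lt (h'.α_pos i).le (h'.β_pos i).le (h'.point i ▸ h'.mem i)
      (h'.point i ▸ hne)
    have hα' := lt_two_mul_of_log_eq (h.α_pos i) (hα i).symm
    have hβ' := lt_two_mul_of_log_eq (h.β_pos i) (hβ i).symm
    -- Equal logarithms keep the coordinates of `2 y i - y' i` positive. The functional has value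
    -- one at `y i` and exceeds one at `y' i`, so it would be below one at this reflected lattice
    -- point.
    have hp : f + (2 * α i - α' i) • r (j (i + 1)) + (2 * β i - β' i) • r (j (i + 2)) =
        y i + (y i - y' i) := by
      rw [h.point, h'.point]; module
    have h2 := h.one_lt (i := i) (a := 2 * α i - α' i) (c := 2 * β i - β' i) (by linarith)
      (by linarith) (hp ▸ mem_lattice_add (h.mem i) (mem_lattice_sub (h.mem i) (h'.mem i)))
      (by
        rw [hp]
        intro e
        exact hne (sub_eq_zero.1 (by simpa using e)).symm)
    linarith [h.edge i]
  have hαβ : ∀ i, α i = α' i ∧ β i = β' i := by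
    intro i
    have h1 := h.linearIndependent_rays (ne i) (a := α i - α' i) (c := β i - β' i) (by
      have := hy i
      rw [h.point, h'.point, ← sub_eq_zero] at this
      rw [← neg_eq_zero, ← this]
      module)
    exact ⟨sub_eq_zero.1 h1.1, sub_eq_zero.1 h1.2⟩
  have hs : s = s' := eq_of_cyclic h.α_pos h.β_pos fun i => by
    rw [h.edge, (hαβ i).1, (hαβ i).2, h'.edge]
  funext i
  rw [h.vertex, h'.vertex, hs]

end

/-! ### Bounds from the encoding size -/

theorem den_le_ratSize (q : ℚ) : (q.den : ℝ) ≤ 2 ^ ratSize q := by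
  have h1 : q.den < 2 ^ q.den.size := Nat.lt_size_self _
  have h2 : 2 ^ q.den.size ≤ 2 ^ ratSize q :=
    Nat.pow_le_pow_right (by norm_num) (by unfold ratSize; omega)
  exact_mod_cast h1.le.trans h2

theorem abs_le_ratSize (q : ℚ) : |(q : ℝ)| ≤ 2 ^ ratSize q := by
  have h1 : q.num.natAbs < 2 ^ q.num.natAbs.size := Nat.lt_size_self _
  have h2 : 2 ^ q.num.natAbs.size ≤ 2 ^ ratSize q :=
    Nat.pow_le_pow_right (by norm_num) (by unfold ratSize; omega)
  have h3 : |(q : ℝ)| ≤ (q.num.natAbs : ℝ) := by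
    rw [Rat.cast_def, abs_div, Nat.abs_cast, Nat.cast_natAbs, Int.cast_abs]
    exact div_le_self (abs_nonneg _) (by exact_mod_cast q.den_pos)
  exact h3.trans (by exact_mod_cast h1.le.trans h2)

theorem exists_denominator (v : Fin 2 → ℚ) : ∃ d : ℕ, 0 < d ∧ (d : ℝ) ≤ 2 ^ vecSize v ∧
    ∀ i, ∃ z : ℤ, (d : ℝ) * toReal v i = z := by
  refine ⟨(v 0).den * (v 1).den, mul_pos (v 0).den_pos (v 1).den_pos, ?_, fun i => ?_⟩
  · rw [vecSize, Fin.sum_univ_two, pow_add]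
    push_cast
    exact mul_le_mul (den_le_ratSize _) (den_le_ratSize _) (Nat.cast_nonneg _) (by positivity)
  · have h : ∀ q : ℚ, (q.den : ℝ) * (q : ℝ) = q.num := fun q => by
      exact_mod_cast q.den_mul_eq_num
    fin_cases i
    · refine ⟨(v 1).den * (v 0).num, ?_⟩
      simp only [toReal, Fin.zero_eta]
      push_cast
      rw [← h]; ring
    · refine ⟨(v 0).den * (v 1).num, ?_⟩
      simp only [toReal, Fin.mk_one]
      push_cast
      rw [← h]; ring

theorem abs_le_vecSize (v : Fin 2 → ℚ) (i : Fin 2) : |toReal v i| ≤ 2 ^ vecSize v := by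
  refine (abs_le_ratSize (v i)).trans (pow_le_pow_right₀ (by norm_num) ?_)
  exact Finset.single_le_sum (f := fun i => ratSize (v i)) (by simp) (Finset.mem_univ i)

/-- Clearing the denominators of `f` and `v` turns the determinant into a nonzero integer. -/
theorem cross_lower_bound {f v : Fin 2 → ℚ} {y : Fin 2 → ℝ} {N : ℕ} (hy : y ∈ lattice)
    (hf : vecSize f ≤ N) (hv : vecSize v ≤ N) (h0 : cross (y - toReal f) (toReal v) ≠ 0) :
    1 ≤ 2 ^ (2 * N) * |cross (y - toReal f) (toReal v)| := by
  obtain ⟨d, hd, hdN, hdz⟩ := exists_denominator f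
  obtain ⟨e, he, heN, hez⟩ := exists_denominator v
  have hint : ∃ z : ℤ, (d : ℝ) * e * cross (y - toReal f) (toReal v) = z := by
    obtain ⟨a, ha⟩ := hdz 0
    obtain ⟨a', ha'⟩ := hdz 1
    obtain ⟨c, hc⟩ := hez 0
    obtain ⟨c', hc'⟩ := hez 1
    obtain ⟨m, hm⟩ := hy 0
    obtain ⟨m', hm'⟩ := hy 1
    refine ⟨(d * m - a) * c' - (d * m' - a') * c, ?_⟩
    push_cast
    rw [← ha, ← ha', ← hc, ← hc', ← hm, ← hm', cross, Pi.sub_apply, Pi.sub_apply]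
    ring
  obtain ⟨z, hz⟩ := hint
  have hd' : (0 : ℝ) < d := by exact_mod_cast hd
  have he' : (0 : ℝ) < e := by exact_mod_cast he
  have hz0 : z ≠ 0 := by
    rintro rfl
    rw [Int.cast_zero] at hz
    exact mul_ne_zero (mul_pos hd' he').ne' h0 hz
  have h1 : (1 : ℝ) ≤ |(z : ℝ)| := by exact_mod_cast Int.one_le_abs hz0
  rw [← hz, abs_mul, abs_of_pos (mul_pos hd' he')] at h1
  refine h1.trans (mul_le_mul_of_nonneg_right ?_ (abs_nonneg _))
  rw [two_mul, pow_add]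
  have hp : ∀ {n : ℕ}, n ≤ N → (2 : ℝ) ^ n ≤ 2 ^ N := fun h => pow_le_pow_right₀ (by norm_num) h
  exact mul_le_mul (hdN.trans (hp hf)) (heN.trans (hp hv)) he'.le (by positivity)

theorem abs_cross_le {v w : Fin 2 → ℚ} {N : ℕ} (hv : vecSize v ≤ N) (hw : vecSize w ≤ N) :
    |cross (toReal v) (toReal w)| ≤ 2 ^ (2 * N + 1) := by
  have hp : ∀ {n : ℕ}, n ≤ N → (2 : ℝ) ^ n ≤ 2 ^ N := fun h => pow_le_pow_right₀ (by norm_num) h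
  have h : ∀ i l, |toReal v i * toReal w l| ≤ 2 ^ N * 2 ^ N := fun i l => by
    rw [abs_mul]
    exact mul_le_mul ((abs_le_vecSize v i).trans (hp hv)) ((abs_le_vecSize w l).trans (hp hw))
      (abs_nonneg _) (by positivity)
  have h1 := abs_sub (toReal v 0 * toReal w 1) (toReal v 1 * toReal w 0)
  rw [cross, pow_succ, two_mul, pow_add]
  linarith [h 0 1, h 1 0]

/-- The dyadic size of a cone coordinate of a minimizing lattice point is bounded linearly in the
encoding size of the cone. -/
theorem log_mem_Icc {f v w : Fin 2 → ℚ} {y : Fin 2 → ℝ} {N : ℕ} {a c s t : ℝ}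
    (hf : vecSize f ≤ N) (hv : vecSize v ≤ N) (hw : vecSize w ≤ N)
    (hcr : cross (toReal v) (toReal w) ≠ 0) (ha : 0 < a) (hc : 0 < c) (hs : 0 < s)
    (hy : y ∈ lattice) (hya : y = toReal f + a • toReal v + c • toReal w)
    (hst : a * s + c * t = 1)
    (hmin : ∀ a' c' : ℝ, 0 ≤ a' → 0 ≤ c' → toReal f + a' • toReal v + c' • toReal w ∈ lattice →
      toReal f + a' • toReal v + c' • toReal w ≠ y → 1 < a' * s + c' * t) :
    Int.log 2 a ∈ Finset.Icc (-((4 * N + 1 : ℕ) : ℤ)) (4 * N + 1 : ℕ) := by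
  rw [Finset.mem_Icc]
  constructor
  -- By Cramer's rule `a` is a quotient of determinants, the numerator at least `2 ^ (-2 * N)` and
  -- the denominator at most `2 ^ (2 * N + 1)` in absolute value.
  · rw [← Int.zpow_le_iff_le_log one_lt_two ha, zpow_neg, zpow_natCast, inv_le_iff_one_le_mul₀ (by positivity)]
    have he : cross (y - toReal f) (toReal w) = a * cross (toReal v) (toReal w) := by
      rw [hya]; simp [cross]; ring
    have h1 := cross_lower_bound hy hf hw (by rw [he]; exact mul_ne_zero ha.ne' hcr)
    rw [he, abs_mul, abs_of_pos ha] at h1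
    calc (1 : ℝ) ≤ 2 ^ (2 * N) * (a * |cross (toReal v) (toReal w)|) := h1
      _ ≤ 2 ^ (2 * N) * (a * 2 ^ (2 * N + 1)) := by gcongr; exact abs_cross_le hv hw
      _ = a * ((2 : ℕ) : ℝ) ^ (4 * N + 1) := by push_cast; ring
  -- Here `d • v` is integral. If `a ≥ d`, subtracting it from `y` would give a lattice point of the
  -- cone with a smaller functional value.
  · obtain ⟨d, hd, hdN, hdz⟩ := exists_denominator v
    have hd' : (0 : ℝ) < d := by exact_mod_cast hd
    have hlt : a < d := by
      by_contra hle
      rw [not_lt] at hle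
      have hp : toReal f + (a - d) • toReal v + c • toReal w = y - (d : ℝ) • toReal v := by
        rw [hya]; module
      have h1 := hmin (a - d) c (by linarith) hc.le
        (by
          rw [hp]
          refine mem_lattice_sub hy fun i => ?_
          exact hdz i)
        (by
          rw [hp, Ne, sub_eq_self, smul_eq_zero, not_or]
          refine ⟨hd'.ne', fun h0 => hcr ?_⟩
          simp [h0, cross])
      have := mul_pos hd' hs
      linarith
    apply Int.le_of_lt_add_one
    rw [← Int.lt_zpow_iff_log_lt one_lt_two ha]
    calc a < d := hlt
      _ ≤ 2 ^ vecSize v := hdN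
      _ ≤ 2 ^ (4 * N + 1 + 1) := pow_le_pow_right₀ (by norm_num) (by omega)
      _ = _ := by norm_cast

theorem CornerData.log_mem {k : ℕ} {f : Fin 2 → ℚ} {r : Fin k → Fin 2 → ℚ}
    {b : AffineBasis (Fin 3) ℝ (Fin 2 → ℝ)} {y : Fin 3 → Fin 2 → ℝ} {j : Fin 3 → Fin k}
    {s α β : Fin 3 → ℝ} (h : CornerData (toReal f) (toReal ∘ r) b y j s α β) (i : Fin 3) :
    Int.log 2 (α i) ∈ Finset.Icc (-((4 * dataSize f r + 1 : ℕ) : ℤ)) (4 * dataSize f r + 1 : ℕ) ∧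
    Int.log 2 (β i) ∈
      Finset.Icc (-((4 * dataSize f r + 1 : ℕ) : ℤ)) (4 * dataSize f r + 1 : ℕ) := by
  have hf : vecSize f ≤ dataSize f r := Nat.le_add_right _ _
  have hr : ∀ n, vecSize (r n) ≤ dataSize f r := fun n =>
    (Finset.single_le_sum (f := fun n => vecSize (r n)) (by simp) (Finset.mem_univ n)).trans
      (Nat.le_add_left _ _)
  have ne : ∀ i : Fin 3, i + 1 ≠ i + 2 := by decide
  constructor
  · exact log_mem_Icc hf (hr _) (hr _) (h.cross_ne_zero (ne i)) (h.α_pos i) (h.β_pos i)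
      (h.s_pos _) (h.mem i) (h.point i) (h.edge i) fun a c ha hc hl hne => h.one_lt ha hc hl hne
  · refine log_mem_Icc hf (hr _) (hr _) (h.cross_ne_zero (ne i).symm) (h.β_pos i) (h.α_pos i)
      (h.s_pos _) (h.mem i) ?_ ((add_comm _ _).trans (h.edge i)) fun a c ha hc hl hne => ?_
    · rw [add_right_comm]; exact h.point i
    · rw [add_right_comm] at hl hne
      rw [add_comm]
      exact h.one_lt hc ha hl hne

/-! ### Counting -/

/-- An integral ray intersection of one triangle is not interior to another lattice-free one, which
bounds the gauge of the first by that of the second; the situation is symmetric. -/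
theorem subsingleton_integral {k : ℕ} (f : Fin 2 → ℝ) (r : Fin k → Fin 2 → ℝ) :
    {γ | ∃ B : Matrix (Fin 3) (Fin 2) ℝ, IsType3Triangle (M f B) ∧
      rayIntersections f B (range r) ⊆ lattice ∧ γ = gam r B}.Subsingleton := by
  have key : ∀ B B' : Matrix (Fin 3) (Fin 2) ℝ, IsType3Triangle (M f B) →
      IsType3Triangle (M f B') → rayIntersections f B' (range r) ⊆ lattice → ∀ n,
      psi B' (r n) ≤ psi B (r n) := by
    intro B B' hB hB' hl n
    by_cases hr : r n = 0
    · rw [hr, psi_zero, psi_zero]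
    by_contra hlt
    rw [not_le] at hlt
    have hpos : 0 < psi B' (r n) := by
      obtain ⟨b, y, h, hM⟩ := hB'.exists_inscribed
      rw [h.psi_eq hM]
      exact h.psi_edgeMatrix_pos hr
    have hmem := hl ⟨r n, mem_range_self n, hpos, rfl⟩
    have hint : f + (1 / psi B' (r n)) • r n ∈ interior (M f B) := by
      refine mem_interior_of_dotProduct_lt_one fun i => ?_
      rw [add_sub_cancel_left, dotProduct_smul, smul_eq_mul, one_div, inv_mul_lt_one₀ hpos]
      exact (le_psi B (r n) i).trans_lt hlt
    have hfree : interior (M f B) ∩ lattice = ∅ := hB.1.prop.2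
    exact eq_empty_iff_forall_notMem.1 hfree _ ⟨hint, hmem⟩
  rintro _ ⟨B, hB, hl, rfl⟩ _ ⟨B', hB', hl', rfl⟩
  funext n
  exact le_antisymm (key B' B hB' hB hl n) (key B B' hB hB' hl' n)

theorem corner_finite_ncard_le {k : ℕ} (f : Fin 2 → ℚ) (r : Fin k → Fin 2 → ℚ) :
    {γ | ∃ B : Matrix (Fin 3) (Fin 2) ℝ, IsType3Triangle (M (toReal f) B) ∧
      verts (toReal f) B ⊆ rayIntersections (toReal f) B (range (toReal ∘ r)) ∧
      γ = gam (toReal ∘ r) B}.Finite ∧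
    {γ | ∃ B : Matrix (Fin 3) (Fin 2) ℝ, IsType3Triangle (M (toReal f) B) ∧
      verts (toReal f) B ⊆ rayIntersections (toReal f) B (range (toReal ∘ r)) ∧
      γ = gam (toReal ∘ r) B}.ncard ≤ k ^ 3 * (2 * (4 * dataSize f r + 1) + 1) ^ 6 := by
  set S := {γ | ∃ B : Matrix (Fin 3) (Fin 2) ℝ, IsType3Triangle (M (toReal f) B) ∧
      verts (toReal f) B ⊆ rayIntersections (toReal f) B (range (toReal ∘ r)) ∧
      γ = gam (toReal ∘ r) B} with hS
  -- For `k = 0` there are no codes at all; a member of `S` supplies the default code that `choose!`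
  -- needs.
  rcases S.eq_empty_or_nonempty with hempty | ⟨γ₀, hγ₀⟩
  · simp [hempty]
  set L := 4 * dataSize f r + 1 with hL
  let K : Finset ((Fin 3 → Fin k) × (Fin 3 → ℤ) × (Fin 3 → ℤ)) :=
    Finset.univ ×ˢ Fintype.piFinset (fun _ => Finset.Icc (-(L : ℤ)) L) ×ˢ
      Fintype.piFinset (fun _ => Finset.Icc (-(L : ℤ)) L)
  have hK : K.card = k ^ 3 * (2 * L + 1) ^ 6 := by
    have h1 : ((L : ℤ) + 1 - -(L : ℤ)).toNat = 2 * L + 1 := by omega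
    simp only [K, Finset.card_product, Fintype.card_piFinset, Int.card_Icc, h1, Finset.prod_const,
      Finset.card_univ, Fintype.card_fun, Fintype.card_fin]
    ring
  let Code : (Fin k → ℝ) → (Fin 3 → Fin k) × (Fin 3 → ℤ) × (Fin 3 → ℤ) → Prop := fun γ c =>
    ∃ b y s α β B, CornerData (toReal f) (toReal ∘ r) b y c.1 s α β ∧
      M (toReal f) B = {x | ∀ i, 0 ≤ b.coord i x} ∧ γ = gam (toReal ∘ r) B ∧
      (∀ i, Int.log 2 (α i) = c.2.1 i) ∧ ∀ i, Int.log 2 (β i) = c.2.2 i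
  have hcode : ∀ γ ∈ S, ∃ c ∈ K, Code γ c := by
    rintro γ ⟨B, hB, hv, rfl⟩
    obtain ⟨b, y, h, hM⟩ := hB.exists_inscribed
    rw [verts, hM, extremePoints_coord_nonneg] at hv
    obtain ⟨j, s, α, β, hc⟩ := h.exists_cornerData hv
    refine ⟨(j, fun i => Int.log 2 (α i), fun i => Int.log 2 (β i)), ?_, b, y, s, α, β, B, hc, hM,
      rfl, fun _ => rfl, fun _ => rfl⟩
    simp only [K, Finset.mem_product, Finset.mem_univ, true_and, Fintype.mem_piFinset]
    exact ⟨fun i => (hc.log_mem i).1, fun i => (hc.log_mem i).2⟩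
  have huniq : ∀ γ γ' c, Code γ c → Code γ' c → γ = γ' := by
    rintro γ γ' c ⟨b, y, s, α, β, B, h, hM, rfl, hα, hβ⟩ ⟨b', y', s', α', β', B', h', hM', rfl, hα', hβ'⟩
    have hb := h.eq_of_log_eq h' (fun i => (hα i).trans (hα' i).symm)
      (fun i => (hβ i).trans (hβ' i).symm)
    have hMM : M (toReal f) B' = {x | ∀ i, 0 ≤ b.coord i x} := by
      rw [hM', ← b.convexHull_eq_nonneg_coord, ← b'.convexHull_eq_nonneg_coord, hb]
    funext n
    rw [gam, gam, h.psi_eq hM, h.psi_eq hMM]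
  have : Nonempty ((Fin 3 → Fin k) × (Fin 3 → ℤ) × (Fin 3 → ℤ)) :=
    ⟨(hcode γ₀ hγ₀).choose⟩
  choose! g hgK hg using hcode
  have hinj : InjOn g S := fun γ hγ γ' hγ' e =>
    huniq γ γ' (g γ) (hg γ hγ) (e ▸ hg γ' hγ')
  constructor
  · exact Finite.of_injOn (t := (K : Set _)) (fun γ hγ => hgK γ hγ) hinj K.finite_toSet
  · rw [← hK, ← ncard_coe_finset]
    exact ncard_le_ncard_of_injOn g (fun γ hγ => hgK γ hγ) hinj K.finite_toSet

theorem card_le_dataSize {k : ℕ} (f : Fin 2 → ℚ) (r : Fin k → Fin 2 → ℚ) : k ≤ dataSize f r := by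
  have h : ∀ n ∈ (Finset.univ : Finset (Fin k)), 1 ≤ vecSize (r n) := fun n _ => by
    simp only [vecSize, ratSize, Fin.sum_univ_two]
    omega
  have h1 := Finset.card_nsmul_le_sum _ _ _ h
  simp only [Finset.card_univ, Fintype.card_fin, smul_eq_mul, mul_one] at h1
  exact h1.trans (Nat.le_add_left _ _)

theorem Xi3_finite_ncard_le {k : ℕ} (f : Fin 2 → ℚ) (r : Fin k → Fin 2 → ℚ) :
    (Xi3 (toReal f) (toReal ∘ r)).Finite ∧ (Xi3 (toReal f) (toReal ∘ r)).ncard ≤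
      1 + dataSize f r ^ 3 * (2 * (4 * dataSize f r + 1) + 1) ^ 6 := by
  have hsub := subsingleton_integral (toReal f) (toReal ∘ r)
  obtain ⟨hfin, hcard⟩ := corner_finite_ncard_le f r
  have hU : Xi3 (toReal f) (toReal ∘ r) =
      {γ | ∃ B : Matrix (Fin 3) (Fin 2) ℝ, IsType3Triangle (M (toReal f) B) ∧
        rayIntersections (toReal f) B (range (toReal ∘ r)) ⊆ lattice ∧ γ = gam (toReal ∘ r) B} ∪
      {γ | ∃ B : Matrix (Fin 3) (Fin 2) ℝ, IsType3Triangle (M (toReal f) B) ∧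
        verts (toReal f) B ⊆ rayIntersections (toReal f) B (range (toReal ∘ r)) ∧
        γ = gam (toReal ∘ r) B} := by
    ext γ
    constructor
    · rintro ⟨B, h, h' | h', e⟩
      · exact Or.inl ⟨B, h, h', e⟩
      · exact Or.inr ⟨B, h, h', e⟩
    · rintro (⟨B, h, h', e⟩ | ⟨B, h, h', e⟩)
      · exact ⟨B, h, Or.inl h', e⟩
      · exact ⟨B, h, Or.inr h', e⟩
  rw [hU]
  refine ⟨hsub.finite.union hfin, (ncard_union_le _ _).trans (add_le_add ?_ (hcard.trans ?_))⟩
  · exact (ncard_le_one hsub.finite).2 fun _ ha _ hb => hsub ha hb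
  · exact Nat.mul_le_mul_right _ (Nat.pow_le_pow_left (card_le_dataSize f r) 3)

/-- A point of `Δ₃` outside `Ξ₃` is the midpoint of two points of `Δ`. -/
theorem exists_strictConvexCombination_of_notMem_Xi3 {k : ℕ} {f : Fin 2 → ℝ}
    {r : Fin k → Fin 2 → ℝ} {γ : Fin k → ℝ} (hγ : γ ∈ Delta3 f r \ Xi3 f r) :
    ∃ γ₁ ∈ Delta f r, ∃ γ₂ ∈ Delta f r, IsStrictConvexCombination γ γ₁ γ₂ := by
  obtain ⟨⟨B, hB, rfl⟩, hX⟩ := hγ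
  obtain ⟨b, y, h, hM⟩ := hB.exists_inscribed
  have hpsi := h.psi_eq hM
  have hgam : gam r B = gam r (edgeMatrix f b) := by
    funext n
    rw [gam, gam, hpsi]
  have hray : rayIntersections f B (range r) = rayIntersections f (edgeMatrix f b) (range r) := by
    rw [rayIntersections, hpsi, rayIntersections]
  have hverts : verts f B = range b := by rw [verts, hM, extremePoints_coord_nonneg]
  have hR : ¬ rayIntersections f B (range r) ⊆ lattice := fun h' => hX ⟨B, hB, Or.inl h', rfl⟩
  have hV : ¬ verts f B ⊆ rayIntersections f B (range r) := fun h' => hX ⟨B, hB, Or.inr h', rfl⟩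
  rw [hverts] at hV
  obtain ⟨_, ⟨m, rfl⟩, hm⟩ := not_subset.1 hV
  rw [hray] at hR hm
  rw [hgam]
  exact h.exists_strictConvexCombination r hm hR

end TriangleClosure

theorem proposition3p7 :
    ∃ p : Polynomial ℕ, ∀ (k : ℕ) (f : Fin 2 → ℚ) (r : Fin k → Fin 2 → ℚ),
      TriangleClosure.Xi3 (TriangleClosure.toReal f) (TriangleClosure.toReal ∘ r) ⊆
        TriangleClosure.Delta3 (TriangleClosure.toReal f) (TriangleClosure.toReal ∘ r) ∧
      (TriangleClosure.Xi3 (TriangleClosure.toReal f) (TriangleClosure.toReal ∘ r)).Finite ∧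
      (TriangleClosure.Xi3 (TriangleClosure.toReal f) (TriangleClosure.toReal ∘ r)).ncard ≤
        p.eval (TriangleClosure.dataSize f r) ∧
      ∀ γ ∈ TriangleClosure.Delta3 (TriangleClosure.toReal f) (TriangleClosure.toReal ∘ r) \
          TriangleClosure.Xi3 (TriangleClosure.toReal f) (TriangleClosure.toReal ∘ r),
        ∃ γ₁ ∈ TriangleClosure.Delta (TriangleClosure.toReal f) (TriangleClosure.toReal ∘ r),
          ∃ γ₂ ∈ TriangleClosure.Delta (TriangleClosure.toReal f) (TriangleClosure.toReal ∘ r),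
            TriangleClosure.IsStrictConvexCombination γ γ₁ γ₂ := by
  -- One vector with integral ray intersections, then three ray indices, using `k ≤ dataSize f r`,
  -- and six logarithms in `[-L, L]` with `L = 4 * dataSize f r + 1`.
  refine ⟨1 + Polynomial.X ^ 3 * (2 * (4 * Polynomial.X + 1) + 1) ^ 6, fun k f r => ?_⟩
  obtain ⟨hfin, hcard⟩ := TriangleClosure.Xi3_finite_ncard_le f r
  refine ⟨?_, hfin, ?_, fun γ hγ => TriangleClosure.exists_strictConvexCombination_of_notMem_Xi3 hγ⟩
  · rintro γ ⟨B, hB, -, e⟩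
    exact ⟨B, hB, e⟩
  · simpa using hcard
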